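/- For real $x,y$ let $\Delta(x,y)=|\operatorname{Arg} e^{\imath(x-y)}|\in[0,\pi]$. For a finite family of nodes $\mathbf y=(y_1,\dots,y_k)$ in $(-\pi,\pi]$ let $\mathbf V_N(\mathbf y)\in\mathbb C^{(N+1)\times k}$ be the Vandermonde matrix with entries $e^{\imath n y_l}$ ($0\le n\le N$, $1\le l\le k$). The $k$ singular values of $\mathbf V_N(\mathbf y)$ are the square roots of the eigenvalues of $\mathbf V_N(\mathbf y)^H\mathbf V_N(\mathbf y)$, counted with multiplicity. Distinct nodes $\mathbf x=\{x_1,\dots,x_s\}\subset(-\pi,\pi]$ form an $((h^{(j)},s^{(j)})_{j=1}^M,\theta)$-clustered configuration, where $h^{(j)}\ge 0$ and $\theta>0$, if there is a partition $\mathbf x=\biguplus_{j=1}^M\mathbf c^{(j)}$ into non-empty parts such that, for each $j$, $\mathbf c^{(j)}$ has $s^{(j)}$ elements, $0<\Delta(x,y)\le h^{(j)}$ for all $x\ne y$ in $\mathbf c^{(j)}$, and $\Delta(x,y)\ge\theta$ for all $x\in\mathbf c^{(j)}$, $y\in\mathbf x\setminus\mathbf c^{(j)}$. **Theorem (Multi-cluster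 Vandermonde matrix singular values).** For every $s_{\max}\in\mathbb N$ there are positive constants $A,B,K_1,K_2$, depending only on $s_{\max}$, with the following property. Let $\mathbf x=\{x_1,\dots,x_s\}$ form an $((h^{(j)},s^{(j)})_{j=1}^M,\theta)$-clustered configuration with clusters $\mathbf c^{(1)},\dots,\mathbf c^{(M)}$, with $s^{(j)}\le s_{\max}$ for all $j$, and put $h=\max_j h^{(j)}$. Set $$C_1=A\,s,\qquad C_2=\frac{B}{s},\qquad C_3=K_1\,s,\qquad C_4=K_2\,s .$$ Let $\sigma_1\ge\dots\ge\sigma_s$ be the singular values of $\mathbf V_N(\mathbf x)$, and let $\tilde\sigma_1\ge\dots\ge\tilde\sigma_s$ be all the singular values of the sub-matrices $\mathbf V_N(\mathbf c^{(1)}),\dots,\mathbf V_N(\mathbf c^{(M)})$ together, counted with multiplicity. Then for every natural number $N$ with $\frac{C_1}{\theta}\le N\le\frac{C_2}{h}$ (the upper bound meaning $Nh\le C_2$, so that it is void for $h=0$), $$1-\frac{C_3}{N\theta}-C_4Nh>0$$ and $$\Bigl(1-\frac{C_3}{N\theta}-C_4Nh\Bigr)^{1/2}\tilde\sigma_j\le\sigma_j\le\Bigl(1+\frac{C_3}{N\theta}+C_4Nh\Bigr)^{1/2}\tilde\sigma_j,\qquad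 j=1,\dots,s .$$ -/

import Mathlib

noncomputable section

/-- The wrap-around distance `Δ(x, y) = |Arg exp(i(x - y))| ∈ [0, π]` of two real numbers. -/
def wrapDist (x y : ℝ) : ℝ :=
  |Complex.arg (Complex.exp (Complex.I * ((x - y : ℝ) : ℂ)))|

/-- The family `y` of nodes in `(-π, π]` forms an `(h, k)`-cluster: it has `k` members, and any
two different members have a wrap-around distance in `(0, h]`. -/
structure IsCluster {ι : Type*} [Fintype ι] (y : ι → ℝ) (h : ℝ) (k : ℕ) : Prop where
  mem_Ioc : ∀ i, y i ∈ Set.Ioc (-Real.pi) Real.pi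
  card_eq : Fintype.card ι = k
  dist_pos : ∀ i i', i ≠ i' → 0 < wrapDist (y i) (y i')
  dist_le : ∀ i i', i ≠ i' → wrapDist (y i) (y i') ≤ h

/-- The sub-family of the nodes `x` that the labelling `c` puts into the `j`-th cluster. -/
def clusterNodes {s M : ℕ} (x : Fin s → ℝ) (c : Fin s → Fin M) (j : Fin M) :
    {i : Fin s // c i = j} → ℝ :=
  fun i => x i

/-- The distinct nodes `x 0, …, x (s - 1)` form an `((h j, k j)_j, θ)`-clustered configuration,
the underlying partition into `M` (non-empty) parts being the one into the fibres of `c`. -/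
structure IsClusteredConfiguration {s M : ℕ} (x : Fin s → ℝ) (c : Fin s → Fin M)
    (h : Fin M → ℝ) (k : Fin M → ℕ) (θ : ℝ) : Prop where
  mem_Ioc : ∀ i, x i ∈ Set.Ioc (-Real.pi) Real.pi
  injective : Function.Injective x
  surjective : Function.Surjective c
  size_nonneg : ∀ j, 0 ≤ h j
  isCluster : ∀ j, IsCluster (clusterNodes x c j) (h j) (k j)
  separation_pos : 0 < θ
  separation : ∀ i i', c i ≠ c i' → θ ≤ wrapDist (x i) (x i')

/-- The `(N + 1) × ι` Vandermonde matrix `V_N(y)` with nodes `exp(i y)`; its entry in row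
`n = 0, …, N` and column `l` is `exp(i n y_l)`. -/
def vandermondeMatrix {ι : Type*} (N : ℕ) (y : ι → ℝ) : Matrix (Fin (N + 1)) ι ℂ :=
  Matrix.of fun n l => Complex.exp (Complex.I * (n : ℕ) * (y l : ℂ))

/-- The singular values of a matrix in non-increasing order, numbered from `0`: the square roots
of the eigenvalues of `Aᴴ A`, with multiplicity, followed by zeros. -/
def matrixSingularValue {m n : Type*} [Fintype m] [Fintype n] [DecidableEq n]
    (A : Matrix m n ℂ) (j : ℕ) : ℝ :=
  (Matrix.toEuclideanLin A).singularValues j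

/-- The multiset union of the singular values of the cluster sub-matrices `V_N(c⁽ʲ⁾)`; a
sub-matrix with `k` columns contributes `k` singular values. -/
def clusterSingularValues {s M : ℕ} (N : ℕ) (x : Fin s → ℝ) (c : Fin s → Fin M) : Multiset ℝ :=
  ∑ j : Fin M, (Multiset.range (Fintype.card {i : Fin s // c i = j})).map
    (matrixSingularValue (vandermondeMatrix N (clusterNodes x c j)))

theorem card_clusterSingularValues {s M : ℕ} (N : ℕ) (x : Fin s → ℝ) (c : Fin s → Fin M) :
    (clusterSingularValues N x c).card = s := by
  have h := Fintype.card_congr (Equiv.sigmaFiberEquiv c)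
  rw [Fintype.card_sigma, Fintype.card_fin] at h
  simpa [clusterSingularValues] using h

/-- The `j`-th largest singular value of all the cluster sub-matrices together, numbered from
`0`. -/
def unionSingularValue {s M : ℕ} (N : ℕ) (x : Fin s → ℝ) (c : Fin s → Fin M) (j : Fin s) : ℝ :=
  ((clusterSingularValues N x c).sort (· ≥ ·)).get
    (j.cast (by rw [Multiset.length_sort, card_clusterSingularValues]))

end

noncomputable section

open Finset Module

/-! Write `V_N(x) v` as the sum of vectors `f j`, where `f j` samples the exponential sum over the
`j`-th cluster. Then `∑ j, ‖f j‖ ^ 2` is the quadratic form of the block diagonal part of the Gram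
matrix, and its eigenvalues are the squared singular values of all the blocks together. It suffices
to bound the cross terms by `K / (N θ) * ‖f j‖ * ‖f l‖`. Since this is relative to the norms of the
`f j` and not of the coefficients, it survives arbitrarily ill-conditioned blocks.

Up to one unimodular frequency, each `f j` varies slowly: a Bernstein type inequality
(`exists_forward_difference_bound`) holds with a constant that depends on the number of nodes but
not on their gaps. Summation by parts against the relative frequency of two clusters bounds the
cross term by `O(1 / θ)` times the product of the maxima. Slowness also makes each maximum `O(‖f j‖
/ √N)`, which gives the factor `1 / (N θ)` (`norm_sum_modulated_mul_conj_le`).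

Cauchy-Schwarz over the at most `s` clusters turns this into a two-sided comparison of quadratic
forms, and the Courant-Fischer argument (`le_of_diagonal_form_le`) transfers it to the singular
values. -/

/-! ### Slowly varying sequences and a Bernstein type inequality. -/

theorem norm_sub_le_of_forward_difference {D : ℕ → ℂ} {L : ℕ} {B : ℝ}
    (hD : ∀ n < L, L * ‖D (n + 1) - D n‖ ≤ B) {p : ℕ} (i : ℕ) (h : p + i ≤ L) :
    L * ‖D (p + i) - D p‖ ≤ i * B := by
  induction i with
  | zero => simp
  | succ i ih =>
    have h1 := ih (by omega)
    have h2 := hD (p + i) (by omega)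
    have h3 : ‖D (p + (i + 1)) - D p‖ ≤ ‖D (p + i + 1) - D (p + i)‖ + ‖D (p + i) - D p‖ := by
      rw [← add_assoc]
      exact norm_sub_le_norm_sub_add_norm_sub _ _ _
    have h4 := mul_le_mul_of_nonneg_left h3 (Nat.cast_nonneg (α := ℝ) L)
    push_cast
    linarith

/-- A sequence whose forward differences on `[0, L]` are at most `C T / L` stays within `T / 2` of
any of its values on a whole interval of length `L / (2 C)`. -/
theorem exists_plateau {D : ℕ → ℂ} {L C : ℕ} {T : ℝ} (hT : 0 ≤ T)
    (hD : ∀ n < L, L * ‖D (n + 1) - D n‖ ≤ C * T) {n₀ : ℕ} (hn₀ : n₀ ≤ L) :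
    ∃ m, m + L / (2 * C) ≤ L ∧ ∀ i ≤ L / (2 * C), ‖D (m + i) - D n₀‖ ≤ T / 2 := by
  set l := L / (2 * C) with hl
  have hlC : (l : ℝ) * (2 * C) ≤ L := by exact_mod_cast Nat.div_mul_le_self L (2 * C)
  have key : ∀ p i, p + i ≤ L → i ≤ l → ‖D (p + i) - D p‖ ≤ T / 2 := by
    intro p i hpi hil
    rcases Nat.eq_zero_or_pos L with h0 | h0
    · have : i = 0 := by omega
      subst this
      simpa using by positivity
    have h1 := norm_sub_le_of_forward_difference hD i hpi
    have h2 : (i : ℝ) * (C * T) ≤ l * (C * T) := by gcongr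
    have h3 : (l : ℝ) * (C * T) ≤ L * (T / 2) := by nlinarith
    exact le_of_mul_le_mul_left (h1.trans (h2.trans h3)) (by exact_mod_cast h0)
  by_cases h : n₀ + l ≤ L
  · exact ⟨n₀, h, fun i hi => key n₀ i (by omega) hi⟩
  -- There is no room to the right of `n₀`, so the window ends there instead; `2 * l ≤ L` ensures `l
  -- ≤ n₀`, so that `n₀ - l` is not truncated.
  · have h2l : 2 * l ≤ L := by
      rcases Nat.eq_zero_or_pos C with h0 | h0
      · simp [hl, h0]
      · have := Nat.div_mul_le_self L (2 * C)
        rw [← hl] at this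
        nlinarith
    refine ⟨n₀ - l, by omega, fun i hi => ?_⟩
    have := key (n₀ - l + i) (l - i) (by omega) (by omega)
    rwa [show n₀ - l + i + (l - i) = n₀ by omega, norm_sub_rev] at this

/-- A Bernstein type inequality: an exponential sum of at most `k` terms whose frequencies lie
within `η / N` of each other has forward differences of size `O(1 / N)` on `[0, N]`. -/
theorem exists_forward_difference_bound (k : ℕ) : ∀ η : ℝ, 0 ≤ η → ∃ C : ℕ, 1 ≤ C ∧
    ∀ (ι : Type) (s : Finset ι) (v z : ι → ℂ) (N : ℕ) (S : ℝ), s.card ≤ k →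
      (∀ a ∈ s, ‖z a‖ = 1) → (∀ a ∈ s, N * ‖z a - 1‖ ≤ η) →
      (∀ n ≤ N, ‖∑ a ∈ s, v a * z a ^ n‖ ≤ S) →
      ∀ n < N, N * ‖∑ a ∈ s, v a * z a ^ (n + 1) - ∑ a ∈ s, v a * z a ^ n‖ ≤ C * S := by
  induction k with
  | zero =>
    intro η _
    refine ⟨1, le_rfl, fun ι s v z N S hs _ _ hS n _ => ?_⟩
    have : s = ∅ := by simpa using hs
    subst this
    simpa using hS 0 (Nat.zero_le _)
  | succ k ih =>
    intro η hη
    obtain ⟨C, hC, H⟩ := ih (2 * η) (by positivity)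
    -- `8 * C` comes from the sum with the frequency of `z b` factored out, `⌈η⌉₊` from that
    -- frequency itself. The doubled `η` above bounds the ratios `z a / z b`.
    refine ⟨8 * C + ⌈η⌉₊, by omega, fun ι s v z N S hs hz hzη hS n hn => ?_⟩
    classical
    have hS0 : 0 ≤ S := (norm_nonneg _).trans (hS 0 (Nat.zero_le _))
    rcases s.eq_empty_or_nonempty with rfl | ⟨b, hb⟩
    · simpa using by positivity
    have hzb : z b ≠ 0 := fun h => by simpa [h] using hz b hb
    set w : ι → ℂ := fun a => z a / z b with hw
    set F : ℕ → ℂ := fun n => ∑ a ∈ s, v a * z a ^ n with hF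
    set G : ℕ → ℂ := fun n => ∑ a ∈ s, v a * w a ^ n with hG
    set D : ℕ → ℂ := fun n => ∑ a ∈ s.erase b, v a * (w a - 1) * w a ^ n with hDdef
    have hFG : ∀ n, F n = z b ^ n * G n := by
      intro n
      simp only [hF, hG, hw, mul_sum, div_pow]
      refine sum_congr rfl fun a _ => ?_
      field_simp
    -- Since `w b = 1`, differencing kills the term of `b`: `D` has one term fewer, and the
    -- induction hypothesis applies to it.
    have hGD : ∀ n, G (n + 1) - G n = D n := by
      intro n
      have : G (n + 1) - G n = ∑ a ∈ s, v a * (w a - 1) * w a ^ n := by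
        simp only [hG, ← sum_sub_distrib]
        exact sum_congr rfl fun a _ => by ring
      rw [this, ← add_sum_erase s _ hb]
      simp [hDdef, hw, div_self hzb]
    have hGS : ∀ n ≤ N, ‖G n‖ ≤ S := by
      intro n hn
      have := hS n hn
      change ‖F n‖ ≤ S at this
      rwa [hFG, norm_mul, norm_pow, hz b hb, one_pow, one_mul] at this
    obtain ⟨n₀, hn₀, hmax⟩ := exists_max_image (range N) (fun n => ‖D n‖)
      ⟨n, mem_range.2 hn⟩
    rw [mem_range] at hn₀
    simp only [mem_range] at hmax
    set T := ‖D n₀‖ with hTdef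
    have hT0 : 0 ≤ T := norm_nonneg _
    have hN1 : ((N - 1 : ℕ) : ℝ) ≤ N := by exact_mod_cast Nat.sub_le N 1
    -- `D n` involves `G (n + 1)`, so it is controlled only for `n ≤ N - 1`.
    have hDD : ∀ n < N - 1, ((N - 1 : ℕ) : ℝ) * ‖D (n + 1) - D n‖ ≤ C * T := by
      refine H ι (s.erase b) (fun a => v a * (w a - 1)) w (N - 1) T ?_ ?_ ?_ ?_
      · rw [card_erase_of_mem hb]; omega
      · intro a ha
        simp [hw, hz a (mem_of_mem_erase ha), hz b hb]
      · intro a ha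
        have ha' := mem_of_mem_erase ha
        have h1 : ‖w a - 1‖ = ‖z a - z b‖ := by
          rw [hw, div_sub_one hzb, norm_div, hz b hb, div_one]
        have h2 : ‖z a - z b‖ ≤ ‖z a - 1‖ + ‖z b - 1‖ := by
          rw [norm_sub_rev (z b)]
          exact norm_sub_le_norm_sub_add_norm_sub _ _ _
        rw [h1]
        calc ((N - 1 : ℕ) : ℝ) * ‖z a - z b‖ ≤ N * (‖z a - 1‖ + ‖z b - 1‖) := by gcongr
          _ ≤ 2 * η := by linarith [hzη a ha', hzη b hb]
      · intro n hn'
        exact hmax n (by omega)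
    obtain ⟨m, hm, hplat⟩ := exists_plateau hT0 hDD (n₀ := n₀) (by omega)
    set l := (N - 1) / (2 * C) with hl
    have hsum : ∑ i ∈ range (l + 1), D (m + i) = G (m + (l + 1)) - G m := by
      have := sum_range_sub (fun i => G (m + i)) (l + 1)
      simp only [add_zero] at this
      rw [← this]
      exact sum_congr rfl fun i _ => by rw [← hGD, add_assoc]
    -- On the plateau the `l + 1` values of `D` nearly align with `D n₀`, so their sum is at least
    -- `(l + 1) * T / 2` in norm; but it telescopes to a difference of two values of `G`, at most `2
    -- * S`.
    have hlow : (l + 1 : ℝ) * T ≤ 2 * S + (l + 1) * (T / 2) := by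
      have e : ((l + 1 : ℕ) : ℂ) * D n₀ =
          (G (m + (l + 1)) - G m) - ∑ i ∈ range (l + 1), (D (m + i) - D n₀) := by
        rw [sum_sub_distrib, hsum]; simp
      have h1 : ‖((l + 1 : ℕ) : ℂ) * D n₀‖ = (l + 1) * T := by
        rw [norm_mul, Complex.norm_natCast]; push_cast; rfl
      have h2 : ‖∑ i ∈ range (l + 1), (D (m + i) - D n₀)‖ ≤ (l + 1) * (T / 2) := by
        refine (norm_sum_le_of_le _ fun i hi => hplat i ?_).trans ?_
        · rw [mem_range] at hi; omega
        · simp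
      rw [← h1, e]
      refine (norm_sub_le _ _).trans (add_le_add ((norm_sub_le _ _).trans ?_) h2)
      have hmN : m ≤ N := (Nat.le_add_right _ _).trans (hm.trans (Nat.sub_le N 1))
      linarith [hGS (m + (l + 1)) (by omega), hGS m hmN]
    have hNl : (N : ℝ) ≤ (l + 1) * (2 * C) := by
      have h1 : N - 1 < (l + 1) * (2 * C) := by
        have := Nat.lt_div_mul_add (a := N - 1) (b := 2 * C) (by omega)
        rw [← hl] at this
        linarith
      have : N ≤ (l + 1) * (2 * C) := by omega
      exact_mod_cast this
    have hNT : (N : ℝ) * T ≤ 8 * C * S := by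
      have h1 : (N : ℝ) * T ≤ (l + 1) * (2 * C) * T := by gcongr
      have h2 : (l + 1 : ℝ) * T ≤ 4 * S := by linarith
      have h3 : (2 * C : ℝ) * ((l + 1) * T) ≤ 2 * C * (4 * S) := by gcongr
      linarith
    change N * ‖F (n + 1) - F n‖ ≤ _
    have hFdiff : F (n + 1) - F n = z b ^ (n + 1) * D n + z b ^ n * ((z b - 1) * G n) := by
      rw [hFG, hFG, ← hGD]; ring
    have hle : ‖F (n + 1) - F n‖ ≤ T + ‖z b - 1‖ * S := by
      rw [hFdiff]
      refine (norm_add_le _ _).trans ?_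
      simp only [norm_mul, norm_pow, hz b hb, one_pow, one_mul]
      have := hmax n hn
      have := hGS n hn.le
      gcongr
    have hceil := Nat.le_ceil η
    push_cast
    calc (N : ℝ) * ‖F (n + 1) - F n‖ ≤ N * (T + ‖z b - 1‖ * S) := by gcongr
      _ = N * T + (N * ‖z b - 1‖) * S := by ring
      _ ≤ 8 * C * S + ⌈η⌉₊ * S := by
        gcongr
        exact (hzη b hb).trans hceil
      _ = _ := by ring

/-- The maximum of a slowly varying sequence is controlled by its quadratic mean. -/
theorem mul_sq_le_sum_sq_of_forward_difference {F : ℕ → ℂ} {N C : ℕ} (hC : 1 ≤ C) {n₀ : ℕ}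
    (hn₀ : n₀ ≤ N) (hF : ∀ n < N, N * ‖F (n + 1) - F n‖ ≤ C * ‖F n₀‖) :
    N * ‖F n₀‖ ^ 2 ≤ 8 * C * ∑ n ∈ range (N + 1), ‖F n‖ ^ 2 := by
  obtain ⟨m, hm, hplat⟩ := exists_plateau (norm_nonneg _) hF hn₀
  set l := N / (2 * C) with hl
  -- On the plateau `‖F‖` is at least half of `‖F n₀‖`. The final `8 * C` is this factor `4` times
  -- the `2 * C` of the plateau length.
  have h1 : (l + 1 : ℝ) * (‖F n₀‖ / 2) ^ 2 ≤ ∑ n ∈ range (N + 1), ‖F n‖ ^ 2 := by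
    calc (l + 1 : ℝ) * (‖F n₀‖ / 2) ^ 2 = ∑ i ∈ range (l + 1), (‖F n₀‖ / 2) ^ 2 := by simp
      _ ≤ ∑ i ∈ range (l + 1), ‖F (m + i)‖ ^ 2 := by
        refine sum_le_sum fun i hi => ?_
        have := hplat i (by rw [mem_range] at hi; omega)
        have h2 := norm_sub_norm_le (F n₀) (F (m + i))
        rw [norm_sub_rev] at h2
        gcongr
        linarith
      _ = ∑ n ∈ (range (l + 1)).map (addLeftEmbedding m), ‖F n‖ ^ 2 := by simp
      _ ≤ _ := by
        refine sum_le_sum_of_subset_of_nonneg ?_ fun _ _ _ => by positivity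
        intro n hn
        simp only [mem_map, mem_range, addLeftEmbedding_apply] at hn ⊢
        omega
  have h2 : (N : ℝ) ≤ (l + 1) * (2 * C) := by
    have := Nat.lt_div_mul_add (a := N) (b := 2 * C) (by omega)
    rw [← hl] at this
    have : N ≤ (l + 1) * (2 * C) := by linarith
    exact_mod_cast this
  calc (N : ℝ) * ‖F n₀‖ ^ 2 ≤ (l + 1) * (2 * C) * ‖F n₀‖ ^ 2 := by gcongr
    _ = 8 * C * ((l + 1) * (‖F n₀‖ / 2) ^ 2) := by ring
    _ ≤ _ := by gcongr

/-! ### Near-orthogonality of separated clusters. -/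

/-- Summation by parts: multiplication by `q - 1` telescopes the powers of `q`, leaving the boundary
terms and the total variation of `H`. -/
theorem norm_sub_one_mul_norm_sum_pow_mul_le {q : ℂ} (hq : ‖q‖ = 1) (H : ℕ → ℂ) (N : ℕ) :
    ‖q - 1‖ * ‖∑ n ∈ range (N + 1), q ^ n * H n‖ ≤
      ‖H N‖ + ‖H 0‖ + ∑ n ∈ range N, ‖H (n + 1) - H n‖ := by
  have e : ∀ N : ℕ, (q - 1) * ∑ n ∈ range (N + 1), q ^ n * H n =
      q ^ (N + 1) * H N - H 0 - ∑ n ∈ range N, q ^ (n + 1) * (H (n + 1) - H n) := by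
    intro N
    induction N with
    | zero => simp; ring
    | succ N ih => rw [sum_range_succ, mul_add, ih, sum_range_succ _ N]; ring
  rw [← norm_mul, e]
  refine (norm_sub_le _ _).trans (add_le_add ((norm_sub_le _ _).trans ?_) ?_)
  · simp [hq]
  · refine (norm_sum_le _ _).trans (le_of_eq ?_)
    simp [hq]

/-- Slowly varying sequences, modulated by different frequencies, are almost orthogonal. -/
theorem norm_sum_modulated_mul_conj_le {F G : ℕ → ℂ} {N C : ℕ} (hC : 1 ≤ C) {q : ℂ}
    (hq : ‖q‖ = 1) {SF SG : ℝ} (hF : ∀ n ≤ N, ‖F n‖ ≤ SF) (hG : ∀ n ≤ N, ‖G n‖ ≤ SG)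
    (hF' : ∀ n < N, N * ‖F (n + 1) - F n‖ ≤ C * SF)
    (hG' : ∀ n < N, N * ‖G (n + 1) - G n‖ ≤ C * SG)
    (hSF : N * SF ^ 2 ≤ 8 * C * ∑ n ∈ range (N + 1), ‖F n‖ ^ 2)
    (hSG : N * SG ^ 2 ≤ 8 * C * ∑ n ∈ range (N + 1), ‖G n‖ ^ 2) :
    N * ‖q - 1‖ * ‖∑ n ∈ range (N + 1), q ^ n * (F n * starRingEnd ℂ (G n))‖ ≤
      32 * C ^ 2 * (√(∑ n ∈ range (N + 1), ‖F n‖ ^ 2) * √(∑ n ∈ range (N + 1), ‖G n‖ ^ 2)) := by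
  have hC' : (1 : ℝ) ≤ C := by exact_mod_cast hC
  have hSF0 : 0 ≤ SF := (norm_nonneg _).trans (hF 0 (Nat.zero_le _))
  have hSG0 : 0 ≤ SG := (norm_nonneg _).trans (hG 0 (Nat.zero_le _))
  rcases Nat.eq_zero_or_pos N with h0 | h0
  · subst h0
    simp only [Nat.cast_zero, zero_mul]
    positivity
  have hN : (0 : ℝ) < N := by exact_mod_cast h0
  set H : ℕ → ℂ := fun n => F n * starRingEnd ℂ (G n) with hHdef
  have hH : ∀ n ≤ N, ‖H n‖ ≤ SF * SG := by
    intro n hn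
    have := hF n hn
    have := hG n hn
    simp only [hHdef, norm_mul, RCLike.norm_conj]
    gcongr
  have hH' : ∀ n < N, ‖H (n + 1) - H n‖ ≤ 2 * C * (SF * SG) / N := by
    intro n hn
    have e : H (n + 1) - H n = (F (n + 1) - F n) * starRingEnd ℂ (G (n + 1)) +
        F n * starRingEnd ℂ (G (n + 1) - G n) := by
      simp only [hHdef, map_sub]; ring
    have h1 := hF' n hn
    have h2 := hG' n hn
    rw [mul_comm, ← le_div_iff₀ hN] at h1 h2
    have h3 := hF n hn.le
    have h4 := hG (n + 1) hn
    calc ‖H (n + 1) - H n‖ ≤ ‖F (n + 1) - F n‖ * ‖G (n + 1)‖ + ‖F n‖ * ‖G (n + 1) - G n‖ := by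
          rw [e]
          refine (norm_add_le _ _).trans ?_
          simp only [norm_mul, RCLike.norm_conj, le_refl]
      _ ≤ C * SF / N * SG + SF * (C * SG / N) := by gcongr
      _ = _ := by ring
  have hA := norm_sub_one_mul_norm_sum_pow_mul_le hq H N
  -- The boundary terms give `2 * (SF * SG)` and the total variation `2 * C * (SF * SG)`; then `1 ≤
  -- C` merges them.
  have hB : ‖q - 1‖ * ‖∑ n ∈ range (N + 1), q ^ n * H n‖ ≤ 4 * C * (SF * SG) := by
    have h1 : ∑ n ∈ range N, ‖H (n + 1) - H n‖ ≤ 2 * C * (SF * SG) := by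
      refine (sum_le_sum fun n hn => hH' n (mem_range.1 hn)).trans (le_of_eq ?_)
      rw [sum_const, card_range, nsmul_eq_mul]
      field_simp
    have h2 : SF * SG ≤ C * (SF * SG) := le_mul_of_one_le_left (by positivity) hC'
    linarith [hH N le_rfl, hH 0 (Nat.zero_le _)]
  have hS : N * (SF * SG) ≤ 8 * C *
      (√(∑ n ∈ range (N + 1), ‖F n‖ ^ 2) * √(∑ n ∈ range (N + 1), ‖G n‖ ^ 2)) := by
    have h1 : √N * SF ≤ √(8 * C) * √(∑ n ∈ range (N + 1), ‖F n‖ ^ 2) := by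
      rw [← Real.sqrt_mul (by positivity)]
      apply Real.le_sqrt_of_sq_le
      rwa [mul_pow, Real.sq_sqrt hN.le]
    have h2 : √N * SG ≤ √(8 * C) * √(∑ n ∈ range (N + 1), ‖G n‖ ^ 2) := by
      rw [← Real.sqrt_mul (by positivity)]
      apply Real.le_sqrt_of_sq_le
      rwa [mul_pow, Real.sq_sqrt hN.le]
    have h3 := mul_le_mul h1 h2 (by positivity) (by positivity)
    have h4 : √(N : ℝ) * √N = N := Real.mul_self_sqrt hN.le
    have h5 : √(8 * C : ℝ) * √(8 * C) = 8 * C := Real.mul_self_sqrt (by positivity)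
    calc N * (SF * SG) = √N * SF * (√N * SG) := by
          rw [show √(N : ℝ) * SF * (√N * SG) = (√N * √N) * (SF * SG) by ring, h4]
      _ ≤ _ := h3
      _ = (√(8 * C) * √(8 * C)) * (√(∑ n ∈ range (N + 1), ‖F n‖ ^ 2) *
          √(∑ n ∈ range (N + 1), ‖G n‖ ^ 2)) := by ring
      _ = _ := by rw [h5]
  calc N * ‖q - 1‖ * ‖∑ n ∈ range (N + 1), q ^ n * H n‖
      = N * (‖q - 1‖ * ‖∑ n ∈ range (N + 1), q ^ n * H n‖) := by ring
    _ ≤ N * (4 * C * (SF * SG)) := by gcongr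
    _ = 4 * C * (N * (SF * SG)) := by ring
    _ ≤ 4 * C * (8 * C *
      (√(∑ n ∈ range (N + 1), ‖F n‖ ^ 2) * √(∑ n ∈ range (N + 1), ‖G n‖ ^ 2))) := by gcongr
    _ = _ := by ring

/-- Chord against arc on the unit circle; the lower bound is Jordan's inequality. -/
theorem norm_exp_I_mul_ofReal_sub (x y : ℝ) :
    2 / Real.pi * wrapDist x y ≤ ‖Complex.exp (Complex.I * x) / Complex.exp (Complex.I * y) - 1‖ ∧
    ‖Complex.exp (Complex.I * x) / Complex.exp (Complex.I * y) - 1‖ ≤ wrapDist x y := by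
  have hz : ‖Complex.exp (Complex.I * x) / Complex.exp (Complex.I * y)‖ = 1 := by
    simp [Complex.norm_exp_I_mul_ofReal]
  have hw : wrapDist x y = InnerProductGeometry.angle
      (Complex.exp (Complex.I * x) / Complex.exp (Complex.I * y)) 1 := by
    rw [Complex.angle_one_right (div_ne_zero (Complex.exp_ne_zero _) (Complex.exp_ne_zero _)),
      ← Complex.exp_sub, wrapDist, Complex.ofReal_sub, mul_sub]
  rw [hw]
  exact ⟨Complex.mul_angle_le_norm_sub hz norm_one, Complex.norm_sub_le_angle hz norm_one⟩

/-- The exponential sum with nodes `x a`, `a ∈ s`, and coefficients `v a`. -/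
def exponentialSum {ι : Type*} (s : Finset ι) (v : ι → ℂ) (x : ι → ℝ) (n : ℕ) : ℂ :=
  ∑ a ∈ s, v a * Complex.exp (Complex.I * n * x a)

/-- Factoring out the frequency of a node of a cluster leaves a slowly varying sequence. -/
theorem exists_slow_factor {k C : ℕ} (hC : 1 ≤ C)
    (H : ∀ (ι : Type) (s : Finset ι) (v z : ι → ℂ) (N : ℕ) (S : ℝ), s.card ≤ k →
      (∀ a ∈ s, ‖z a‖ = 1) → (∀ a ∈ s, N * ‖z a - 1‖ ≤ 1) →
      (∀ n ≤ N, ‖∑ a ∈ s, v a * z a ^ n‖ ≤ S) →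
      ∀ n < N, N * ‖∑ a ∈ s, v a * z a ^ (n + 1) - ∑ a ∈ s, v a * z a ^ n‖ ≤ C * S)
    {ι : Type} {s : Finset ι} (hs : s.card ≤ k) (v : ι → ℂ) {x : ι → ℝ} {N : ℕ}
    (hx : ∀ a ∈ s, ∀ b ∈ s, N * wrapDist (x a) (x b) ≤ 1) {b : ι} (hb : b ∈ s) :
    ∃ (F : ℕ → ℂ) (S : ℝ),
      (∀ n, exponentialSum s v x n = Complex.exp (Complex.I * x b) ^ n * F n) ∧
      (∀ n ≤ N, ‖F n‖ ≤ S) ∧ (∀ n < N, N * ‖F (n + 1) - F n‖ ≤ C * S) ∧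
      N * S ^ 2 ≤ 8 * C * ∑ n ∈ range (N + 1), ‖F n‖ ^ 2 := by
  set z : ι → ℂ := fun a => Complex.exp (Complex.I * x a) / Complex.exp (Complex.I * x b)
  set F : ℕ → ℂ := fun n => ∑ a ∈ s, v a * z a ^ n
  obtain ⟨n₀, hn₀, hmax⟩ := exists_max_image (range (N + 1)) (fun n => ‖F n‖) ⟨0, by simp⟩
  have hmax' : ∀ n ≤ N, ‖F n‖ ≤ ‖F n₀‖ := fun n hn => hmax n (by simpa using by omega)
  have hF' := H ι s v z N ‖F n₀‖ hs
    (fun a _ => by simp [z, Complex.norm_exp_I_mul_ofReal])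
    (fun a ha => le_trans (by gcongr; exact (norm_exp_I_mul_ofReal_sub _ _).2) (hx a ha b hb))
    hmax'
  refine ⟨F, ‖F n₀‖, fun n => ?_, hmax', hF',
    mul_sq_le_sum_sq_of_forward_difference hC (by simpa [Nat.lt_succ_iff] using hn₀) hF'⟩
  simp only [exponentialSum, F, z, mul_sum, div_pow]
  refine sum_congr rfl fun a _ => ?_
  have h1 : Complex.exp (Complex.I * n * x a) = Complex.exp (Complex.I * x a) ^ n := by
    rw [← Complex.exp_nat_mul]; ring_nf
  rw [h1]
  field_simp

/-- Exponential sums over two clusters at a distance `θ` are orthogonal up to `O(1 / (N θ))`. -/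
theorem exists_norm_sum_exponentialSum_mul_conj_le (k : ℕ) : ∃ K : ℝ, 0 < K ∧
    ∀ (ι : Type) (s t : Finset ι) (v : ι → ℂ) (x : ι → ℝ) (N : ℕ) (θ : ℝ),
      s.card ≤ k → t.card ≤ k →
      (∀ a ∈ s, ∀ b ∈ s, N * wrapDist (x a) (x b) ≤ 1) →
      (∀ a ∈ t, ∀ b ∈ t, N * wrapDist (x a) (x b) ≤ 1) →
      (∀ a ∈ s, ∀ b ∈ t, θ ≤ wrapDist (x a) (x b)) →
      N * θ * ‖∑ n ∈ range (N + 1),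
          exponentialSum s v x n * starRingEnd ℂ (exponentialSum t v x n)‖ ≤
        K * (√(∑ n ∈ range (N + 1), ‖exponentialSum s v x n‖ ^ 2) *
          √(∑ n ∈ range (N + 1), ‖exponentialSum t v x n‖ ^ 2)) := by
  obtain ⟨C, hC, H⟩ := exists_forward_difference_bound k 1 zero_le_one
  have hpi := Real.pi_pos
  refine ⟨Real.pi / 2 * (32 * C ^ 2), by positivity, ?_⟩
  intro ι s t v x N θ hs ht hxs hxt hst
  rcases s.eq_empty_or_nonempty with rfl | ⟨a, ha⟩
  · simp [exponentialSum]
  rcases t.eq_empty_or_nonempty with rfl | ⟨b, hb⟩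
  · simp [exponentialSum]
  obtain ⟨F, SF, hfF, hF, hF', hSF⟩ := exists_slow_factor hC H hs v hxs ha
  obtain ⟨G, SG, hgG, hG, hG', hSG⟩ := exists_slow_factor hC H ht v hxt hb
  have e1 : ∀ n, ‖exponentialSum s v x n‖ = ‖F n‖ := fun n => by
    rw [hfF]; simp [Complex.norm_exp_I_mul_ofReal]
  have e2 : ∀ n, ‖exponentialSum t v x n‖ = ‖G n‖ := fun n => by
    rw [hgG]; simp [Complex.norm_exp_I_mul_ofReal]
  set q : ℂ := Complex.exp (Complex.I * x a) / Complex.exp (Complex.I * x b) with hq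
  have hq1 : ‖q‖ = 1 := by simp [q, Complex.norm_exp_I_mul_ofReal]
  have hconj : starRingEnd ℂ (Complex.exp (Complex.I * x b)) =
      (Complex.exp (Complex.I * x b))⁻¹ := by
    rw [← Complex.exp_conj, ← Complex.exp_neg]; simp
  have e3 : ∀ n, exponentialSum s v x n * starRingEnd ℂ (exponentialSum t v x n) =
      q ^ n * (F n * starRingEnd ℂ (G n)) := fun n => by
    rw [hfF, hgG, map_mul, map_pow, hconj, hq, div_pow, inv_pow]
    ring
  have key := norm_sum_modulated_mul_conj_le hC hq1 hF hG hF' hG' hSF hSG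
  simp only [e1, e2, e3]
  have hθ : θ ≤ Real.pi / 2 * ‖q - 1‖ := by
    have h1 := hst a ha b hb
    have h2 := (norm_exp_I_mul_ofReal_sub (x a) (x b)).1
    rw [div_mul_eq_mul_div, div_le_iff₀ hpi] at h2
    linarith
  calc N * θ * ‖∑ n ∈ range (N + 1), q ^ n * (F n * starRingEnd ℂ (G n))‖
      ≤ N * (Real.pi / 2 * ‖q - 1‖) *
          ‖∑ n ∈ range (N + 1), q ^ n * (F n * starRingEnd ℂ (G n))‖ := by gcongr
    _ = Real.pi / 2 * (N * ‖q - 1‖ *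
          ‖∑ n ∈ range (N + 1), q ^ n * (F n * starRingEnd ℂ (G n))‖) := by ring
    _ ≤ Real.pi / 2 * (32 * C ^ 2 * _) := by gcongr
    _ = _ := by ring

/-! ### Eigenvalue comparison for quadratic forms. -/

theorem OrthonormalBasis.norm_sq_eq_sum_norm_sq_repr {ι E : Type*} [Fintype ι]
    [NormedAddCommGroup E] [InnerProductSpace ℂ E] (b : OrthonormalBasis ι ℂ E) (v : E) :
    ‖v‖ ^ 2 = ∑ i, ‖b.repr v i‖ ^ 2 := by
  rw [← b.repr.norm_map v, EuclideanSpace.norm_sq_eq]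

section Comparison

variable {ι κ E : Type*} [Fintype ι] [Fintype κ] [NormedAddCommGroup E] [InnerProductSpace ℂ E]
  [FiniteDimensional ℂ E]

/-- Two coordinate subspaces whose dimensions add up to more than `dim E` intersect. -/
theorem exists_ne_zero_repr_eq_zero (b : OrthonormalBasis ι ℂ E) (e : OrthonormalBasis κ ℂ E)
    (I : Finset ι) (J : Finset κ) (h : finrank ℂ E < I.card + J.card) :
    ∃ v : E, v ≠ 0 ∧ (∀ i ∉ I, b.repr v i = 0) ∧ ∀ i ∉ J, e.repr v i = 0 := by
  classical
  let f : E →ₗ[ℂ] ({i // i ∉ I} → ℂ) × ({i // i ∉ J} → ℂ) :=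
    LinearMap.prod (LinearMap.pi fun i => (b.toBasis.coord i.1))
      (LinearMap.pi fun i => (e.toBasis.coord i.1))
  have h1 : finrank ℂ E = Fintype.card ι := finrank_eq_card_basis b.toBasis
  have h2 : finrank ℂ E = Fintype.card κ := finrank_eq_card_basis e.toBasis
  have hI := card_le_univ I
  have hJ := card_le_univ J
  -- The number of vanishing conditions, `(dim E - #I) + (dim E - #J)`, is less than `dim E`.
  have hker : LinearMap.ker f ≠ ⊥ := by
    refine LinearMap.ker_ne_bot_of_finrank_lt ?_
    rw [finrank_prod, finrank_fintype_fun_eq_card, finrank_fintype_fun_eq_card,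
      Fintype.card_subtype_compl, Fintype.card_subtype_compl, Fintype.card_coe, Fintype.card_coe]
    omega
  obtain ⟨v, hv, hv0⟩ := Submodule.exists_mem_ne_zero_of_ne_bot hker
  rw [LinearMap.mem_ker, Prod.ext_iff] at hv
  refine ⟨v, hv0, fun i hi => ?_, fun i hi => ?_⟩
  · simpa [f] using congrFun hv.1 ⟨i, hi⟩
  · simpa [f] using congrFun hv.2 ⟨i, hi⟩

/-- The comparison principle behind the Courant-Fischer theorem: if one diagonal quadratic form is
bounded by another one, then so are their eigenvalues. -/
theorem le_of_diagonal_form_le (b : OrthonormalBasis ι ℂ E) (e : OrthonormalBasis κ ℂ E)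
    {α : ι → ℝ} {β : κ → ℝ}
    (hle : ∀ v, ∑ i, α i * ‖b.repr v i‖ ^ 2 ≤ ∑ i, β i * ‖e.repr v i‖ ^ 2)
    {I : Finset ι} {J : Finset κ} (h : finrank ℂ E < I.card + J.card) {a c : ℝ}
    (ha : ∀ i ∈ I, a ≤ α i) (hc : ∀ i ∈ J, β i ≤ c) : a ≤ c := by
  obtain ⟨v, hv0, hb, he⟩ := exists_ne_zero_repr_eq_zero b e I J h
  have h1 : a * ‖v‖ ^ 2 ≤ ∑ i, α i * ‖b.repr v i‖ ^ 2 := by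
    rw [b.norm_sq_eq_sum_norm_sq_repr v, mul_sum]
    refine sum_le_sum fun i _ => ?_
    by_cases hi : i ∈ I
    · have := ha i hi
      gcongr
    · simp [hb i hi]
  have h2 : ∑ i, β i * ‖e.repr v i‖ ^ 2 ≤ c * ‖v‖ ^ 2 := by
    rw [e.norm_sq_eq_sum_norm_sq_repr v, mul_sum]
    refine sum_le_sum fun i _ => ?_
    by_cases hi : i ∈ J
    · have := hc i hi
      gcongr
    · simp [he i hi]
  have hv : 0 < ‖v‖ ^ 2 := by positivity
  exact le_of_mul_le_mul_right (h1.trans ((hle v).trans h2)) hv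

/-- The basis diagonalises `T* T`, whose eigenvalues are the squared singular values. -/
theorem LinearMap.exists_orthonormalBasis_norm_sq_apply {F : Type*} [NormedAddCommGroup F]
    [InnerProductSpace ℂ F] [FiniteDimensional ℂ F] (T : E →ₗ[ℂ] F) {n : ℕ}
    (hn : finrank ℂ E = n) : ∃ e : OrthonormalBasis (Fin n) ℂ E,
      ∀ v, ‖T v‖ ^ 2 = ∑ i : Fin n, T.singularValues i ^ 2 * ‖e.repr v i‖ ^ 2 := by
  refine ⟨T.isSymmetric_adjoint_comp_self.eigenvectorBasis hn, fun v => ?_⟩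
  set e := T.isSymmetric_adjoint_comp_self.eigenvectorBasis hn with he
  have h1 : inner ℂ v ((LinearMap.adjoint T ∘ₗ T) v) = ((‖T v‖ ^ 2 : ℝ) : ℂ) := by
    rw [LinearMap.comp_apply, LinearMap.adjoint_inner_right, inner_self_eq_norm_sq_to_K]
    push_cast; rfl
  have h2 : inner ℂ v ((LinearMap.adjoint T ∘ₗ T) v) =
      ((∑ i : Fin n, T.singularValues i ^ 2 * ‖e.repr v i‖ ^ 2 : ℝ) : ℂ) := by
    rw [← e.repr.inner_map_map, PiLp.inner_apply, Complex.ofReal_sum]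
    refine sum_congr rfl fun i _ => ?_
    rw [he, LinearMap.IsSymmetric.eigenvectorBasis_apply_self_apply, ← he,
      ← T.sq_singularValues_fin hn i, RCLike.inner_apply, mul_assoc]
    have := Complex.mul_conj' (e.repr v i)
    rw [this]
    push_cast; rfl
  exact_mod_cast h1.symm.trans h2

end Comparison

/-! ### The blocks together and their sorted singular values. -/

/-- The part of a coefficient vector that belongs to the `j`-th cluster. -/
def clusterPart {s M : ℕ} (c : Fin s → Fin M) (j : Fin M) (v : EuclideanSpace ℂ (Fin s)) :
    EuclideanSpace ℂ {i : Fin s // c i = j} :=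
  WithLp.toLp 2 fun i => v i

/-- The singular values of the cluster sub-matrices, indexed by cluster and position. -/
def clusterSingularValue {s M : ℕ} (N : ℕ) (x : Fin s → ℝ) (c : Fin s → Fin M)
    (p : Σ j : Fin M, Fin (Fintype.card {i : Fin s // c i = j})) : ℝ :=
  matrixSingularValue (vandermondeMatrix N (clusterNodes x c p.1)) p.2

theorem clusterSingularValue_nonneg {s M : ℕ} (N : ℕ) (x : Fin s → ℝ) (c : Fin s → Fin M)
    (p : Σ j : Fin M, Fin (Fintype.card {i : Fin s // c i = j})) :
    0 ≤ clusterSingularValue N x c p :=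
  LinearMap.singularValues_nonneg _ _

/-- Lets counts in the sorted list be read as cardinalities of index sets, as
`le_of_diagonal_form_le` requires. -/
theorem clusterSingularValues_eq_map {s M : ℕ} (N : ℕ) (x : Fin s → ℝ) (c : Fin s → Fin M) :
    clusterSingularValues N x c = Finset.univ.val.map (clusterSingularValue N x c) := by
  have key : ∀ (α : Type) (t : Finset α) (f : α → ℝ),
      t.val.map f = ∑ a ∈ t, ({f a} : Multiset ℝ) := fun α t f => by
    rw [Finset.sum, ← Multiset.sum_map_singleton (t.val.map f), Multiset.map_map]; rfl
  rw [key, Fintype.sum_sigma, clusterSingularValues]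
  refine sum_congr rfl fun j _ => ?_
  rw [← Finset.range_val, key, Finset.sum_range]
  rfl

/-- The coefficient space is the orthogonal sum of the cluster coordinate spaces, so singular bases
of the blocks concatenate to an orthonormal basis of the whole. -/
theorem exists_orthonormalBasis_sum_norm_sq_clusterPart {s M : ℕ} (N : ℕ) (x : Fin s → ℝ)
    (c : Fin s → Fin M) :
    ∃ b : OrthonormalBasis (Σ j : Fin M, Fin (Fintype.card {i : Fin s // c i = j})) ℂ
      (EuclideanSpace ℂ (Fin s)), ∀ v,
      ∑ j, ‖Matrix.toEuclideanLin (vandermondeMatrix N (clusterNodes x c j))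
        (clusterPart c j v)‖ ^ 2 = ∑ p, clusterSingularValue N x c p ^ 2 * ‖b.repr v p‖ ^ 2 := by
  have H := fun j : Fin M =>
    (Matrix.toEuclideanLin (vandermondeMatrix N
      (clusterNodes x c j))).exists_orthonormalBasis_norm_sq_apply
      (n := Fintype.card {i : Fin s // c i = j}) finrank_euclideanSpace
  choose B hB using H
  let iso : EuclideanSpace ℂ (Fin s) ≃ₗᵢ[ℂ]
      PiLp 2 (fun j : Fin M => EuclideanSpace ℂ {i : Fin s // c i = j}) :=
    (LinearIsometryEquiv.piLpCongrLeft 2 ℂ ℂ (Equiv.sigmaFiberEquiv c).symm).trans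
      (LinearIsometryEquiv.piLpCurry ℂ 2 fun _ _ => ℂ)
  refine ⟨(Pi.orthonormalBasis B).map iso.symm, fun v => ?_⟩
  rw [Fintype.sum_sigma]
  refine sum_congr rfl fun j _ => ?_
  rw [hB]
  rfl

section SortedList

variable {L : List ℝ}

/-- The entries at positions `0, …, j` all qualify, and ties can only add more; hence an inequality,
which is insensitive to multiplicities. -/
theorem List.succ_le_countP_get_le (hL : L.Pairwise (· ≥ ·)) (j : Fin L.length) :
    j + 1 ≤ L.countP (L.get j ≤ ·) :=
  calc (j : ℕ) + 1 = (L.take (j + 1)).length := by rw [List.length_take]; omega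
    _ = (L.take (j + 1)).countP (L.get j ≤ ·) := by
      symm
      rw [List.countP_eq_length]
      intro a ha
      obtain ⟨i, hi, rfl⟩ := List.mem_take_iff_getElem.1 ha
      have hij : (⟨i, by omega⟩ : Fin L.length) ≤ j := by
        rw [Fin.le_def]; simp only; omega
      simpa using hL.rel_get_of_le hij
    _ ≤ _ := (List.take_sublist _ _).countP_le

theorem List.length_sub_le_countP_le_get (hL : L.Pairwise (· ≥ ·)) (j : Fin L.length) :
    L.length - j ≤ L.countP (· ≤ L.get j) :=
  calc L.length - j = (L.drop j).length := by rw [List.length_drop]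
    _ = (L.drop j).countP (· ≤ L.get j) := by
      symm
      rw [List.countP_eq_length]
      intro a ha
      obtain ⟨i, hi, rfl⟩ := List.mem_drop_iff_getElem.1 ha
      have hij : j ≤ (⟨j + i, by omega⟩ : Fin L.length) := by
        rw [Fin.le_def]; simp
      simpa using hL.rel_get_of_le hij
    _ ≤ _ := (List.drop_sublist _ _).countP_le

end SortedList

theorem Multiset.countP_sort (m : Multiset ℝ) (p : ℝ → Prop) [DecidablePred p] :
    (m.sort (· ≥ ·)).countP (p ·) = m.countP p := by
  conv_rhs => rw [← m.sort_eq (· ≥ ·)]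
  rw [Multiset.coe_countP]

section UnionOfBlocks

variable {s M : ℕ} (N : ℕ) (x : Fin s → ℝ) (c : Fin s → Fin M) (j : Fin s)

theorem unionSingularValue_nonneg : 0 ≤ unionSingularValue N x c j := by
  have h : unionSingularValue N x c j ∈ clusterSingularValues N x c := by
    rw [← Multiset.mem_sort (r := (· ≥ ·))]
    exact List.get_mem _ _
  rw [clusterSingularValues_eq_map, Multiset.mem_map] at h
  obtain ⟨p, -, hp⟩ := h
  rw [← hp]
  exact clusterSingularValue_nonneg N x c p

theorem succ_le_card_unionSingularValue_le :
    j + 1 ≤ #{p | unionSingularValue N x c j ≤ clusterSingularValue N x c p} := by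
  have h := List.succ_le_countP_get_le ((clusterSingularValues N x c).pairwise_sort (· ≥ ·))
    (j.cast (by rw [Multiset.length_sort, card_clusterSingularValues]))
  change (j : ℕ) + 1 ≤ List.countP (unionSingularValue N x c j ≤ ·) _ at h
  rwa [Multiset.countP_sort _ (unionSingularValue N x c j ≤ ·), clusterSingularValues_eq_map,
    Multiset.countP_map] at h

theorem sub_le_card_le_unionSingularValue :
    s - j ≤ #{p | clusterSingularValue N x c p ≤ unionSingularValue N x c j} := by
  have h := List.length_sub_le_countP_le_get
    ((clusterSingularValues N x c).pairwise_sort (· ≥ ·))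
    (j.cast (by rw [Multiset.length_sort, card_clusterSingularValues]))
  change List.length _ - (j : ℕ) ≤ List.countP (· ≤ unionSingularValue N x c j) _ at h
  rwa [Multiset.length_sort, card_clusterSingularValues,
    Multiset.countP_sort _ (· ≤ unionSingularValue N x c j), clusterSingularValues_eq_map,
    Multiset.countP_map] at h

variable {N x c}

/-- If the Gram matrix is at least `r` times its block diagonal part, then every singular value is
at least `√r` times the corresponding one of the blocks. -/
theorem sqrt_mul_unionSingularValue_le {r : ℝ} (hr : 0 ≤ r)
    (h : ∀ v, r * ∑ j, ‖Matrix.toEuclideanLin (vandermondeMatrix N (clusterNodes x c j))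
      (clusterPart c j v)‖ ^ 2 ≤ ‖Matrix.toEuclideanLin (vandermondeMatrix N x) v‖ ^ 2) :
    √r * unionSingularValue N x c j ≤ matrixSingularValue (vandermondeMatrix N x) j := by
  set T := Matrix.toEuclideanLin (vandermondeMatrix N x)
  obtain ⟨b, hb⟩ := exists_orthonormalBasis_sum_norm_sq_clusterPart N x c
  obtain ⟨e, he⟩ := T.exists_orthonormalBasis_norm_sq_apply (n := s) finrank_euclideanSpace_fin
  have ht := unionSingularValue_nonneg N x c j
  have h1 : r * unionSingularValue N x c j ^ 2 ≤ T.singularValues j ^ 2 := by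
    -- The index sets have at least `j + 1` and exactly `s - j` elements, one more in total than the
    -- dimension `s`.
    refine le_of_diagonal_form_le b e (α := fun p => r * clusterSingularValue N x c p ^ 2)
      (β := fun i => T.singularValues i ^ 2)
      (I := {p | unionSingularValue N x c j ≤ clusterSingularValue N x c p}) (J := Finset.Ici j)
      (fun v => ?_) ?_ ?_ ?_
    · simp only [mul_assoc, ← mul_sum]
      rw [← hb, ← he]
      exact h v
    · rw [finrank_euclideanSpace_fin, Fin.card_Ici]
      have := succ_le_card_unionSingularValue_le N x c j
      omega
    · intro p hp
      rw [mem_filter] at hp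
      have := hp.2
      gcongr
    · intro i hi
      rw [Finset.mem_Ici] at hi
      have := T.singularValues_antitone (show (j : ℕ) ≤ i from hi)
      have := T.singularValues_nonneg i
      gcongr
  have h2 : (√r * unionSingularValue N x c j) ^ 2 ≤ T.singularValues j ^ 2 := by
    rwa [mul_pow, Real.sq_sqrt hr]
  exact le_of_sq_le_sq h2 (T.singularValues_nonneg j)

/-- If the Gram matrix is at most `r` times its block diagonal part, then every singular value is
at most `√r` times the corresponding one of the blocks. -/
theorem matrixSingularValue_le_sqrt_mul {r : ℝ} (hr : 0 ≤ r)
    (h : ∀ v, ‖Matrix.toEuclideanLin (vandermondeMatrix N x) v‖ ^ 2 ≤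
      r * ∑ j, ‖Matrix.toEuclideanLin (vandermondeMatrix N (clusterNodes x c j))
        (clusterPart c j v)‖ ^ 2) :
    matrixSingularValue (vandermondeMatrix N x) j ≤ √r * unionSingularValue N x c j := by
  set T := Matrix.toEuclideanLin (vandermondeMatrix N x)
  obtain ⟨b, hb⟩ := exists_orthonormalBasis_sum_norm_sq_clusterPart N x c
  obtain ⟨e, he⟩ := T.exists_orthonormalBasis_norm_sq_apply (n := s) finrank_euclideanSpace_fin
  have ht := unionSingularValue_nonneg N x c j
  have h1 : T.singularValues j ^ 2 ≤ r * unionSingularValue N x c j ^ 2 := by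
    -- The mirrored count: `j + 1` indices up to `j`, and at least `s - j` block singular values
    -- below the threshold.
    refine le_of_diagonal_form_le e b (β := fun p => r * clusterSingularValue N x c p ^ 2)
      (α := fun i => T.singularValues i ^ 2)
      (J := {p | clusterSingularValue N x c p ≤ unionSingularValue N x c j}) (I := Finset.Iic j)
      (fun v => ?_) ?_ ?_ ?_
    · simp only [mul_assoc, ← mul_sum]
      rw [← hb, ← he]
      exact h v
    · rw [finrank_euclideanSpace_fin, Fin.card_Iic]
      have := sub_le_card_le_unionSingularValue N x c j
      omega
    · intro i hi
      rw [Finset.mem_Iic] at hi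
      have := T.singularValues_antitone (show (i : ℕ) ≤ j from hi)
      have := T.singularValues_nonneg j
      gcongr
    · intro p hp
      rw [mem_filter] at hp
      have := hp.2
      have := clusterSingularValue_nonneg N x c p
      gcongr
  have h2 : T.singularValues j ^ 2 ≤ (√r * unionSingularValue N x c j) ^ 2 := by
    rwa [mul_pow, Real.sq_sqrt hr]
  exact le_of_sq_le_sq h2 (by positivity)

end UnionOfBlocks

/-! ### The Gram matrix and its block diagonal part. -/

/-- Almost orthogonal vectors almost satisfy Pythagoras' theorem. -/
theorem abs_norm_sum_sq_sub_sum_norm_sq_le {E : Type*} [NormedAddCommGroup E]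
    [InnerProductSpace ℂ E] {M : ℕ} (f : Fin M → E) {δ : ℝ} (hδ : 0 ≤ δ)
    (h : ∀ j l, j ≠ l → ‖inner ℂ (f j) (f l)‖ ≤ δ * (‖f j‖ * ‖f l‖)) :
    |‖∑ j, f j‖ ^ 2 - ∑ j, ‖f j‖ ^ 2| ≤ δ * M * ∑ j, ‖f j‖ ^ 2 := by
  have e1 : ‖∑ j, f j‖ ^ 2 = ∑ j, ∑ l, (inner ℂ (f j) (f l)).re := by
    have := inner_self_eq_norm_sq (𝕜 := ℂ) (∑ j, f j)
    rw [← this, sum_inner]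
    simp only [inner_sum, map_sum]
    rfl
  have e2 : ∑ j, ‖f j‖ ^ 2 = ∑ j, ∑ l, if j = l then ‖f j‖ ^ 2 else 0 := by simp
  have e3 : |‖∑ j, f j‖ ^ 2 - ∑ j, ‖f j‖ ^ 2| ≤ ∑ j, ∑ l, δ * (‖f j‖ * ‖f l‖) := by
    rw [e1, e2, ← sum_sub_distrib]
    refine (abs_sum_le_sum_abs _ _).trans (sum_le_sum fun j _ => ?_)
    rw [← sum_sub_distrib]
    refine (abs_sum_le_sum_abs _ _).trans (sum_le_sum fun l _ => ?_)
    by_cases hjl : j = l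
    · subst hjl
      have := inner_self_eq_norm_sq (𝕜 := ℂ) (f j)
      rw [if_pos rfl, ← this]
      simp only [RCLike.re_to_complex, sub_self, abs_zero]
      positivity
    · rw [if_neg hjl, sub_zero]
      exact (Complex.abs_re_le_norm _).trans (h j l hjl)
  have e4 : ∑ j, ∑ l, δ * (‖f j‖ * ‖f l‖) = δ * (∑ j, ‖f j‖) ^ 2 := by
    rw [sq, sum_mul_sum, mul_sum]
    simp only [mul_sum]
  have e5 : (∑ j, ‖f j‖) ^ 2 ≤ M * ∑ j, ‖f j‖ ^ 2 := by
    simpa using sq_sum_le_card_mul_sum_sq (s := univ) (f := fun j => ‖f j‖)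
  calc _ ≤ _ := e3
    _ = _ := e4
    _ ≤ δ * (M * ∑ j, ‖f j‖ ^ 2) := by gcongr
    _ = _ := by ring

section Blocks

variable {s M : ℕ} (N : ℕ) (x : Fin s → ℝ) (c : Fin s → Fin M) (v : EuclideanSpace ℂ (Fin s))

theorem toEuclideanLin_clusterPart_apply (j : Fin M) (n : Fin (N + 1)) :
    Matrix.toEuclideanLin (vandermondeMatrix N (clusterNodes x c j)) (clusterPart c j v) n =
      exponentialSum {i | c i = j} v x n := by
  rw [Matrix.ofLp_toLpLin, Matrix.toLin'_apply, exponentialSum, Matrix.mulVec, dotProduct,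
    ← sum_subtype_of_mem (p := fun i => c i = j) (s := {i | c i = j})
      (fun i => v i * Complex.exp (Complex.I * (n : ℕ) * x i)) (fun i hi => (mem_filter.1 hi).2)]
  have : Finset.subtype (fun i => c i = j) ({i | c i = j} : Finset (Fin s)) = univ := by
    ext i; simp [i.2]
  rw [this]
  exact sum_congr rfl fun i _ => mul_comm _ _

theorem toEuclideanLin_eq_sum_clusterPart :
    Matrix.toEuclideanLin (vandermondeMatrix N x) v =
      ∑ j, Matrix.toEuclideanLin (vandermondeMatrix N (clusterNodes x c j))
        (clusterPart c j v) := by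
  ext n
  rw [WithLp.ofLp_sum, Finset.sum_apply]
  simp only [toEuclideanLin_clusterPart_apply, exponentialSum]
  rw [sum_fiberwise, Matrix.ofLp_toLpLin, Matrix.toLin'_apply, Matrix.mulVec, dotProduct]
  exact sum_congr rfl fun i _ => mul_comm _ _

theorem norm_toEuclideanLin_clusterPart (j : Fin M) :
    ‖Matrix.toEuclideanLin (vandermondeMatrix N (clusterNodes x c j)) (clusterPart c j v)‖ =
      √(∑ n ∈ range (N + 1), ‖exponentialSum {i | c i = j} v x n‖ ^ 2) := by
  rw [EuclideanSpace.norm_eq, Finset.sum_range]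
  simp only [toEuclideanLin_clusterPart_apply]

theorem inner_toEuclideanLin_clusterPart (j l : Fin M) :
    inner ℂ (Matrix.toEuclideanLin (vandermondeMatrix N (clusterNodes x c j)) (clusterPart c j v))
      (Matrix.toEuclideanLin (vandermondeMatrix N (clusterNodes x c l)) (clusterPart c l v)) =
      ∑ n ∈ range (N + 1), exponentialSum {i | c i = l} v x n *
        starRingEnd ℂ (exponentialSum {i | c i = j} v x n) := by
  rw [PiLp.inner_apply, Finset.sum_range]
  simp only [toEuclideanLin_clusterPart_apply, RCLike.inner_apply]

end Blocks

theorem wrapDist_self (x : ℝ) : wrapDist x x = 0 := by simp [wrapDist]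

theorem IsClusteredConfiguration.wrapDist_le {s M : ℕ} {x : Fin s → ℝ} {c : Fin s → Fin M}
    {h : Fin M → ℝ} {k : Fin M → ℕ} {θ : ℝ} (H : IsClusteredConfiguration x c h k θ)
    {a b : Fin s} (hab : c a = c b) : wrapDist (x a) (x b) ≤ ⨆ j, h j := by
  have hle : h (c b) ≤ ⨆ j, h j := le_ciSup (Set.finite_range h).bddAbove _
  by_cases e : a = b
  · subst e
    rw [wrapDist_self]
    exact (H.size_nonneg _).trans hle
  · exact ((H.isCluster (c b)).dist_le ⟨a, hab⟩ ⟨b, rfl⟩ (by simpa using e)).trans hle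

/-- The Gram matrix of a clustered configuration is close to its block diagonal part. -/
theorem exists_abs_norm_sq_sub_sum_norm_sq_clusterPart_le (smax : ℕ) : ∃ K : ℝ, 0 < K ∧
    ∀ (s M : ℕ) (x : Fin s → ℝ) (c : Fin s → Fin M) (h : Fin M → ℝ) (k : Fin M → ℕ) (θ : ℝ),
      IsClusteredConfiguration x c h k θ → (∀ j, k j ≤ smax) →
      ∀ N : ℕ, 0 < N → N * (⨆ j, h j) ≤ 1 → ∀ v : EuclideanSpace ℂ (Fin s),
        |‖Matrix.toEuclideanLin (vandermondeMatrix N x) v‖ ^ 2 -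
            ∑ j, ‖Matrix.toEuclideanLin (vandermondeMatrix N (clusterNodes x c j))
              (clusterPart c j v)‖ ^ 2| ≤
          K * s / (N * θ) *
            ∑ j, ‖Matrix.toEuclideanLin (vandermondeMatrix N (clusterNodes x c j))
              (clusterPart c j v)‖ ^ 2 := by
  obtain ⟨K, hK, hcross⟩ := exists_norm_sum_exponentialSum_mul_conj_le smax
  refine ⟨K, hK, fun s M x c h k θ H hk N hN hNh v => ?_⟩
  have hθ := H.separation_pos
  have hNθ : 0 < N * θ := by positivity
  have hcard : ∀ j, ({i | c i = j} : Finset (Fin s)).card ≤ smax := fun j => by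
    rw [← Fintype.card_subtype, (H.isCluster j).card_eq]
    exact hk j
  have hclose : ∀ j, ∀ a ∈ ({i | c i = j} : Finset (Fin s)),
      ∀ b ∈ ({i | c i = j} : Finset (Fin s)), N * wrapDist (x a) (x b) ≤ 1 := by
    intro j a ha b hb
    rw [mem_filter] at ha hb
    refine le_trans ?_ hNh
    gcongr
    exact H.wrapDist_le (ha.2.trans hb.2.symm)
  -- Clusters are non-empty; this trades the number of clusters for the number of nodes.
  have hMs : (M : ℝ) ≤ s := by
    have := Fintype.card_le_of_surjective c H.surjective
    rw [Fintype.card_fin, Fintype.card_fin] at this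
    exact_mod_cast this
  rw [toEuclideanLin_eq_sum_clusterPart N x c v]
  refine (abs_norm_sum_sq_sub_sum_norm_sq_le _ (δ := K / (N * θ)) (by positivity)
    fun j l hjl => ?_).trans ?_
  -- `l` comes before `j` because the inner product conjugates its first argument.
  · have := hcross (Fin s) {i | c i = l} {i | c i = j} v x N θ (hcard l) (hcard j)
      (hclose l) (hclose j) fun a ha b hb => by
        rw [mem_filter] at ha hb
        exact H.separation a b (by rw [ha.2, hb.2]; exact hjl.symm)
    rw [inner_toEuclideanLin_clusterPart, norm_toEuclideanLin_clusterPart,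
      norm_toEuclideanLin_clusterPart, div_mul_eq_mul_div, le_div_iff₀ hNθ]
    linarith
  · refine mul_le_mul_of_nonneg_right ?_ (sum_nonneg fun _ _ => by positivity)
    rw [div_mul_eq_mul_div]
    gcongr

end

/-! ### Choice of the constants. -/

/-- The Gram matrix differs from its block diagonal part by a factor `O(s / (N θ))` only, so that
any positive `K₂` will do; the bound on `N h` is used through `N h ≤ 1`. -/
theorem theorem2p2 (smax : ℕ) :
    ∃ A B K₁ K₂ : ℝ, 0 < A ∧ 0 < B ∧ 0 < K₁ ∧ 0 < K₂ ∧
      ∀ (s M : ℕ) (x : Fin s → ℝ) (c : Fin s → Fin M) (h : Fin M → ℝ) (k : Fin M → ℕ) (θ : ℝ),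
        IsClusteredConfiguration x c h k θ →
        (∀ j, k j ≤ smax) →
        ∀ N : ℕ, A * s / θ ≤ N → N * (⨆ j, h j) ≤ B / s →
          0 < 1 - K₁ * s / (N * θ) - K₂ * s * (N * (⨆ j, h j)) ∧
          ∀ j : Fin s,
            √(1 - K₁ * s / (N * θ) - K₂ * s * (N * (⨆ j, h j))) * unionSingularValue N x c j
                ≤ matrixSingularValue (vandermondeMatrix N x) j ∧
            matrixSingularValue (vandermondeMatrix N x) j
                ≤ √(1 + K₁ * s / (N * θ) + K₂ * s * (N * (⨆ j, h j)))
                  * unionSingularValue N x c j := by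
  obtain ⟨K, hK, hgram⟩ := exists_abs_norm_sq_sub_sum_norm_sq_clusterPart_le smax
  -- `A = 4 * K` and `B = 1 / 4` make each of the two error terms at most `1 / 4`, so the lower
  -- factor is at least `1 / 2`.
  refine ⟨4 * K, 1 / 4, K, 1, by positivity, by norm_num, hK, one_pos, ?_⟩
  intro s M x c h k θ H hk N hNθ hNh
  rcases Nat.eq_zero_or_pos s with rfl | hs
  · exact ⟨by simp, fun j => j.elim0⟩
  have hθ := H.separation_pos
  have hs1 : (1 : ℝ) ≤ s := by exact_mod_cast hs
  have hN0 : (0 : ℝ) < N := lt_of_lt_of_le (by positivity) hNθ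
  have hh0 : 0 ≤ ⨆ j, h j := Real.iSup_nonneg H.size_nonneg
  have h1 : K * s / (N * θ) ≤ 1 / 4 := by
    rw [div_le_iff₀ hθ] at hNθ
    rw [div_le_iff₀ (by positivity)]
    linarith
  have h2 : 1 * (s : ℝ) * (N * ⨆ j, h j) ≤ 1 / 4 := by
    rw [le_div_iff₀ (by positivity)] at hNh
    linarith
  have h3 : 0 ≤ K * s / (N * θ) := by positivity
  have h4 : 0 ≤ 1 * (s : ℝ) * (N * ⨆ j, h j) := by positivity
  have hNh1 : N * (⨆ j, h j) ≤ 1 := by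
    have : N * (⨆ j, h j) ≤ s * (N * ⨆ j, h j) := le_mul_of_one_le_left (by positivity) hs1
    linarith
  have key := hgram s M x c h k θ H hk N (by exact_mod_cast hN0) hNh1
  refine ⟨by linarith, fun j =>
    ⟨sqrt_mul_unionSingularValue_le j (by linarith) fun v => ?_,
      matrixSingularValue_le_sqrt_mul j (by linarith) fun v => ?_⟩⟩
  -- The term with `K₂` is non-negative, so including it only weakens both bounds.
  all_goals
    have hv := abs_le.1 (key v)
    have hS : 0 ≤ ∑ j, ‖Matrix.toEuclideanLin (vandermondeMatrix N (clusterNodes x c j))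
        (clusterPart c j v)‖ ^ 2 := Finset.sum_nonneg fun _ _ => by positivity
    have := mul_nonneg h4 hS
    linarith [hv.1, hv.2]
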